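/- Let $d\ge 1$ and $M\ge 2$ be integers, let $\mathcal X\subset\mathbb R^d$ have nonempty interior, and let $\mathcal Y=[M]=\{1,\dots,M\}$. Let $\alpha\in[0,1]$, $\beta\ge 0$ and $c_\alpha>0$. For $c_\beta>0$ let $\mathcal P=\mathcal P(c_\beta)$ be the collection of all probability distributions $P$ on $\mathcal X\times\mathcal Y$, with $(X,Y)\sim P$ and marginal $P_X$ of $X$, whose conditional probability $p(m|x)=P(Y=m\,|\,X=x)$ has a version satisfying, for every $m\in[M]$, (i) (Hölder smoothness) $|p(m|x')-p(m|x)|\le c_\alpha\|x'-x\|_2^\alpha$ for all $x,x'\in\mathcal X$; (ii) (small value bound) $P_X\bigl(p(m|X)\le t\bigr)\le c_\beta t^\beta$ for all $t\in(0,1]$. For a measurable predictor $f:\mathcal X\to\Delta^{M-1}=\{\theta\in\mathbb R^M:\theta_m\ge 0,\ \sum_m\theta_m=1\}$ let $$\mathcal R_{L_{\mathrm{CE}},P}(f)=\int_{\mathcal X\times\mathcal Y}-\log f(x)_y\,dP(x,y)\in[0,\infty]$$ be its cross-entropy risk (with $-\log 0=\infty$), and let $\mathcal R^*_{L_{\mathrm{CE}},P}$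 be the infimum of the risk over all measurable predictors. Then there exist $c_{\beta,0}>0$ and $c\in(0,1]$, depending only on $\mathcal X,d,M,\alpha,\beta,c_\alpha$, such that for every $c_\beta\ge c_{\beta,0}$, every $n_p\ge 1$ and every learning algorithm $\mathcal A$, i.e. every map from $(\mathcal X\times\mathcal Y)^{n_p}$ to the set of measurable predictors, there is a distribution $P\in\mathcal P(c_\beta)$ for which, for a sample $D_p\sim P^{n_p}$, $$\mathcal R_{L_{\mathrm{CE}},P}(\mathcal A(D_p))-\mathcal R^*_{L_{\mathrm{CE}},P}\ \ge\ c\,n_p^{-\frac{(1+\beta\wedge 1)\alpha}{(1+\beta\wedge 1)\alpha+d}}$$ with probability $P^{n_p}$ at least $(3-2\sqrt2)/8$ (outer probability, should the event not be measurable). -/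

import Mathlib

open MeasureTheory Set
open scoped ENNReal

/-- The cross-entropy loss `-log p ∈ [0, ∞]` of a predicted probability `p ∈ [0, 1]`;
it is `∞` at `p = 0`. -/
noncomputable def ceLoss (p : ℝ) : ℝ≥0∞ :=
  if p = 0 then ⊤ else ENNReal.ofReal (-Real.log p)

/-- Measurable predictors `f : 𝒳 → Δ^{M-1}`; the value `f x m` is the predicted probability of
class `m` at `x`. -/
def Predictor {d : ℕ} (𝒳 : Set (EuclideanSpace ℝ (Fin d))) (M : ℕ) : Type :=
  {f : 𝒳 → Fin M → ℝ // Measurable f ∧ ∀ x, f x ∈ stdSimplex ℝ (Fin M)}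

section

variable {d M : ℕ} {𝒳 : Set (EuclideanSpace ℝ (Fin d))}

/-- The cross-entropy risk `∫ -log f(y|x) dP(x,y) ∈ [0, ∞]` of a predictor. -/
noncomputable def ceRisk (P : Measure (𝒳 × Fin M)) (f : Predictor 𝒳 M) : ℝ≥0∞ :=
  ∫⁻ z, ceLoss (f.1 z.1 z.2) ∂P

/-- The minimal cross-entropy risk over all measurable predictors. -/
noncomputable def ceRiskMin (P : Measure (𝒳 × Fin M)) : ℝ≥0∞ :=
  ⨅ f : Predictor 𝒳 M, ceRisk P f

/-- The excess cross-entropy risk. For `M ≥ 1` the subtrahend is finite (at most `log M`) and never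
larger than the minuend, so this is the true difference, with value `∞` if the risk is `∞`. -/
noncomputable def ceExcessRisk (P : Measure (𝒳 × Fin M)) (f : Predictor 𝒳 M) : ℝ≥0∞ :=
  ceRisk P f - ceRiskMin P

/-- `η` is (a version of) the conditional probability `η(x)_m = P(Y = m | X = x)`:
`P(X ∈ B, Y = m) = ∫_B η(x)_m dP_X(x)` for all measurable `B` and all classes `m`. -/
def IsCondProb (P : Measure (𝒳 × Fin M)) (η : Predictor 𝒳 M) : Prop :=
  ∀ B : Set 𝒳, MeasurableSet B → ∀ m : Fin M,
    P (B ×ˢ {m}) = ∫⁻ x in B, ENNReal.ofReal (η.1 x m) ∂P.fst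

/-- The probability distributions on `𝒳 × [M]` whose conditional probability `p(m|x)` is
`α`-Hölder with constant `cα` on `𝒳` and satisfies the small value bound
`P_X (p(m|X) ≤ t) ≤ cβ t^β` for all `t ∈ (0, 1]`, for every class `m`. -/
def holderSmallValueClass (𝒳 : Set (EuclideanSpace ℝ (Fin d))) (M : ℕ) (α β cα cβ : ℝ) :
    Set (Measure (𝒳 × Fin M)) :=
  {P | IsProbabilityMeasure P ∧ ∃ η : Predictor 𝒳 M, IsCondProb P η ∧
    (∀ m : Fin M, ∀ x x' : 𝒳,
      |η.1 x' m - η.1 x m| ≤ cα * ‖(x' : EuclideanSpace ℝ (Fin d)) - x‖ ^ α) ∧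
    (∀ m : Fin M, ∀ t ∈ Ioc (0 : ℝ) 1,
      P.fst {x | η.1 x m ≤ t} ≤ ENNReal.ofReal (cβ * t ^ β))}

/-- The rate exponent `(1 + β ∧ 1) α / ((1 + β ∧ 1) α + d)`. -/
noncomputable def ceRateExponent (d : ℕ) (α β : ℝ) : ℝ :=
  (1 + min β 1) * α / ((1 + min β 1) * α + d)

end

/-! This is an Assouad argument over distributions with finitely many atoms. Put mass `W` evenly on
a grid of `N ^ d` points with spacing of order `1 / N`, and the rest on one remote atom. At each
grid point class `k` has probability `lo` or `hi = lo + δ`, chosen by a free sign. A second class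
absorbs the change, and every other class has probability `1 / M`.

Pointwise, excess cross-entropy dominates the squared Hellinger distance (`sum_mul_ceLoss_add_le`),
so each misread sign costs at least `(√hi - √lo) ^ 2 / 4` times the mass of its atom. Flipping one
sign changes the law of one observation by squared Hellinger distance at most `2 * (W / N ^ d) *
(√hi - √lo) ^ 2`. While `n * W * (√hi - √lo) ^ 2 ≤ N ^ d / 4`, a fixed fraction of the signs is
therefore misread with probability at least `1 / 16` (`exists_le_prob_mistakes`), and the excess
risk is of order `W * (√hi - √lo) ^ 2`.

Hölder smoothness allows `δ` of order `N ^ (-α)`, and the small value bound allows `W = lo ^ β`. The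
best `lo` is `δ` when `β ≤ 1` and a constant when `β ≥ 1`. Either way `W * (√hi - √lo) ^ 2` is of
order `δ ^ (1 + min β 1)` (`exists_levels`). Balancing gives `N` of order `n ^ (1 / ((1 + min β 1) *
α + d))`, hence the rate. -/

/-! ### Cross-entropy dominates squared Hellinger distance -/

/-- Multiply `log √(q / p) ≤ √(q / p) - 1` by `2 * p`. The terms `p` and `q` cancel after summing
over classes; the additive form avoids truncated subtraction and allows infinite loss. -/
theorem mul_ceLoss_add_le {p q : ℝ} (hp : 0 ≤ p) (hp1 : p ≤ 1) (hq : 0 ≤ q) (hq1 : q ≤ 1) :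
    ENNReal.ofReal p * ceLoss p + ENNReal.ofReal ((√p - √q) ^ 2) + ENNReal.ofReal p ≤
      ENNReal.ofReal p * ceLoss q + ENNReal.ofReal q := by
  rcases hp.eq_or_lt with rfl | hp0
  · simp [Real.sq_sqrt hq]
  rcases hq.eq_or_lt with rfl | hq0
  · simp [ceLoss, ENNReal.mul_top, hp0]
  have hlp : 0 ≤ -Real.log p := by linarith [Real.log_nonpos hp hp1]
  have hlq : 0 ≤ -Real.log q := by linarith [Real.log_nonpos hq hq1]
  simp only [ceLoss, hp0.ne', hq0.ne', if_false]
  rw [← ENNReal.ofReal_mul hp, ← ENNReal.ofReal_mul hp,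
    ← ENNReal.ofReal_add (mul_nonneg hp hlp) (sq_nonneg _),
    ← ENNReal.ofReal_add (add_nonneg (mul_nonneg hp hlp) (sq_nonneg _)) hp,
    ← ENNReal.ofReal_add (mul_nonneg hp hlq) hq]
  apply ENNReal.ofReal_le_ofReal
  have hsp := Real.sqrt_pos.2 hp0
  have hsq := Real.sqrt_pos.2 hq0
  have h1 := Real.log_le_sub_one_of_pos (div_pos hsq hsp)
  rw [Real.log_div hsq.ne' hsp.ne', Real.log_sqrt hq, Real.log_sqrt hp] at h1
  have h2 : p * (√q / √p) = √p * √q := by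
    nth_rewrite 1 [← Real.mul_self_sqrt hp]
    field_simp
  have h3 := mul_le_mul_of_nonneg_left h1 hp
  have h4 := Real.sq_sqrt hp
  have h5 := Real.sq_sqrt hq
  nlinarith [h3, h2, h4, h5]

theorem sum_mul_ceLoss_add_le {M : ℕ} {p q : Fin M → ℝ} (hp : p ∈ stdSimplex ℝ (Fin M))
    (hq : q ∈ stdSimplex ℝ (Fin M)) (k : Fin M) :
    ∑ y, ENNReal.ofReal (p y) * ceLoss (p y) + ENNReal.ofReal ((√(p k) - √(q k)) ^ 2) ≤
      ∑ y, ENNReal.ofReal (p y) * ceLoss (q y) := by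
  have hle : ∀ r ∈ stdSimplex ℝ (Fin M), ∀ y, r y ≤ 1 := fun r hr y => by
    rw [← hr.2]; exact Finset.single_le_sum (fun i _ => hr.1 i) (Finset.mem_univ y)
  have hone : ∀ r ∈ stdSimplex ℝ (Fin M), ∑ y, ENNReal.ofReal (r y) = 1 := fun r hr => by
    rw [← ENNReal.ofReal_sum_of_nonneg fun i _ => hr.1 i, hr.2, ENNReal.ofReal_one]
  have hsum := Finset.sum_le_sum (s := Finset.univ) fun y _ =>
    mul_ceLoss_add_le (hp.1 y) (hle p hp y) (hq.1 y) (hle q hq y)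
  simp only [Finset.sum_add_distrib, hone p hp, hone q hq] at hsum
  have hsum' := (ENNReal.add_le_add_iff_right ENNReal.one_ne_top).1 hsum
  refine le_trans ?_ hsum'
  gcongr
  exact Finset.single_le_sum (f := fun y => ENNReal.ofReal ((√(p y) - √(q y)) ^ 2))
    (fun _ _ => zero_le) (Finset.mem_univ k)

theorem mul_ceLoss_self_ne_top (p : ℝ) : ENNReal.ofReal p * ceLoss p ≠ ⊤ := by
  by_cases hp : p = 0
  · simp [hp]
  · simp only [ceLoss, hp, if_false]
    exact ENNReal.mul_ne_top ENNReal.ofReal_ne_top ENNReal.ofReal_ne_top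

theorem measurable_ceLoss : Measurable ceLoss := by
  unfold ceLoss
  exact Measurable.ite (measurableSet_singleton 0) measurable_const
    (Real.measurable_log.neg.ennreal_ofReal)

/-! ### Testing and Assouad's lemma on finite sample spaces -/

/-- Le Cam's bound for the overlap of two `n`-fold products by the Hellinger distance. -/
theorem le_sum_min_prod {Z : Type*} [Fintype Z] {p q : Z → ℝ} (hp : ∀ z, 0 ≤ p z)
    (hq : ∀ z, 0 ≤ q z) (hp1 : ∑ z, p z = 1) (hq1 : ∑ z, q z = 1) (n : ℕ) :
    (1 - n * ∑ z, (√(p z) - √(q z)) ^ 2) / 2 ≤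
      ∑ D : Fin n → Z, min (∏ i, p (D i)) (∏ i, q (D i)) := by
  classical
  set H := ∑ z, (√(p z) - √(q z)) ^ 2
  have hH : ∑ z, √(p z) * √(q z) = 1 - H / 2 := by
    have : H = ∑ z, p z + ∑ z, q z - 2 * ∑ z, √(p z) * √(q z) := by
      simp only [H, Finset.mul_sum, ← Finset.sum_add_distrib, ← Finset.sum_sub_distrib]
      refine Finset.sum_congr rfl fun z _ => ?_
      nlinarith [Real.sq_sqrt (hp z), Real.sq_sqrt (hq z)]
    linarith
  have hH2 : H ≤ 2 := by
    have : 0 ≤ ∑ z, √(p z) * √(q z) := by positivity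
    linarith
  have hpP : ∀ D : Fin n → Z, 0 ≤ ∏ i, p (D i) := fun D => Finset.prod_nonneg fun i _ => hp _
  have hqP : ∀ D : Fin n → Z, 0 ≤ ∏ i, q (D i) := fun D => Finset.prod_nonneg fun i _ => hq _
  -- The Hellinger affinity tensorizes; writing `√(P * Q) = √min * √max` prepares Cauchy–Schwarz,
  -- with `∑ max ≤ 2`.
  have haff : ∑ D : Fin n → Z, √(min (∏ i, p (D i)) (∏ i, q (D i))) *
      √(max (∏ i, p (D i)) (∏ i, q (D i))) = (1 - H / 2) ^ n := by
    rw [← hH, Fintype.sum_pow]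
    refine Finset.sum_congr rfl fun D _ => ?_
    rw [← Real.sqrt_mul (le_min (hpP D) (hqP D)), min_mul_max, Real.sqrt_mul (hpP D),
      Real.sqrt_prod _ fun i _ => hp _, Real.sqrt_prod _ fun i _ => hq _, Finset.prod_mul_distrib]
  have hmax : ∑ D : Fin n → Z, max (∏ i, p (D i)) (∏ i, q (D i)) ≤ 2 := by
    calc _ ≤ ∑ D : Fin n → Z, (∏ i, p (D i) + ∏ i, q (D i)) :=
          Finset.sum_le_sum fun D _ => max_le_add_of_nonneg (hpP D) (hqP D)
      _ = 2 := by
          rw [Finset.sum_add_distrib, ← Fintype.sum_pow, ← Fintype.sum_pow, hp1, hq1]; norm_num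
  have hCS := Finset.sum_mul_sq_le_sq_mul_sq (Finset.univ : Finset (Fin n → Z))
    (fun D => √(min (∏ i, p (D i)) (∏ i, q (D i)))) (fun D => √(max (∏ i, p (D i)) (∏ i, q (D i))))
  have e1 : ∀ D : Fin n → Z, √(min (∏ i, p (D i)) (∏ i, q (D i))) ^ 2 =
      min (∏ i, p (D i)) (∏ i, q (D i)) := fun D => Real.sq_sqrt (le_min (hpP D) (hqP D))
  have e2 : ∀ D : Fin n → Z, √(max (∏ i, p (D i)) (∏ i, q (D i))) ^ 2 =
      max (∏ i, p (D i)) (∏ i, q (D i)) := fun D => Real.sq_sqrt (le_max_of_le_left (hpP D))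
  simp only [e1, e2, haff] at hCS
  have hmin0 : 0 ≤ ∑ D : Fin n → Z, min (∏ i, p (D i)) (∏ i, q (D i)) :=
    Finset.sum_nonneg fun D _ => le_min (hpP D) (hqP D)
  -- Bernoulli for the squared affinity: `(1 - H / 2) ^ (2 * n) ≥ 1 - n * H`.
  have hB := one_add_mul_le_pow (a := -(H / 2)) (by linarith) (2 * n)
  have hpow : ((1 - H / 2) ^ n) ^ 2 = (1 + -(H / 2)) ^ (2 * n) := by
    rw [← pow_mul, mul_comm]; ring
  push_cast at hB
  nlinarith [mul_le_mul_of_nonneg_left hmax hmin0]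

/-- Assouad's lemma in probability: some sign vector is misidentified by `ψ` in at least a
sixteenth of its coordinates with probability at least `1 / 16`. -/
theorem exists_le_prob_mistakes {J Z : Type*} [Fintype J] [DecidableEq J] [Nonempty J]
    [Fintype Z] (q : (J → Bool) → Z → ℝ) (hq : ∀ σ z, 0 ≤ q σ z) (hq1 : ∀ σ, ∑ z, q σ z = 1)
    (n : ℕ) (hH : ∀ σ j, n * ∑ z, (√(q σ z) - √(q (Function.update σ j (!σ j)) z)) ^ 2 ≤ 1 / 2)
    (ψ : (Fin n → Z) → J → Bool) :
    ∃ σ : J → Bool, 1 / 16 ≤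
      ∑ D : Fin n → Z with (Fintype.card J : ℝ) ≤ 16 * ({j | ψ D j ≠ σ j} : Finset J).card,
        ∏ i, q σ (D i) := by
  classical
  have hm : (0 : ℝ) < Fintype.card J := by exact_mod_cast Fintype.card_pos
  have hP : ∀ σ (D : Fin n → Z), 0 ≤ ∏ i, q σ (D i) :=
    fun σ D => Finset.prod_nonneg fun i _ => hq _ _
  have hcell : ∀ j, (Fintype.card (J → Bool) : ℝ) / 8 ≤
      ∑ σ : J → Bool, ∑ D : Fin n → Z, (∏ i, q σ (D i)) * if ψ D j ≠ σ j then 1 else 0 := by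
    intro j
    set F : (J → Bool) → ℝ := fun σ =>
      ∑ D : Fin n → Z, (∏ i, q σ (D i)) * if ψ D j ≠ σ j then 1 else 0
    have hinv : Function.Involutive fun σ : J → Bool => Function.update σ j (!σ j) := by
      intro σ; simp
    have hswap : ∑ σ, F (Function.update σ j (!σ j)) = ∑ σ, F σ :=
      Equiv.sum_comp hinv.toPerm F
    -- On every sample `ψ` errs at `j` for exactly one of `σ` and its flip, so the two error
    -- probabilities add up to at least the overlap of the product laws.
    have hpair : ∀ σ, 1 / 4 ≤ F σ + F (Function.update σ j (!σ j)) := by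
      intro σ
      have h1 := le_sum_min_prod (hq σ) (hq (Function.update σ j (!σ j))) (hq1 _) (hq1 _) n
      have h2 := hH σ j
      refine le_trans (by linarith) (h1.trans ?_)
      simp only [F, ← Finset.sum_add_distrib]
      refine Finset.sum_le_sum fun D _ => ?_
      by_cases h : ψ D j = σ j
      · have : ψ D j ≠ !σ j := by rw [h]; simp
        simp [h]
      · simp [h]
    have := Finset.sum_le_sum (s := Finset.univ) fun σ _ => hpair σ
    rw [Finset.sum_add_distrib, hswap] at this
    simp only [Finset.sum_const, Finset.card_univ, nsmul_eq_mul] at this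
    linarith
  have htot : ∑ σ : J → Bool, (Fintype.card J : ℝ) / 8 ≤ ∑ σ : J → Bool, ∑ D : Fin n → Z,
      (∏ i, q σ (D i)) * (({j | ψ D j ≠ σ j} : Finset J).card : ℝ) := by
    have := Finset.sum_le_sum (s := (Finset.univ : Finset J)) fun j _ => hcell j
    have e : ∑ σ : J → Bool, ∑ D : Fin n → Z,
        (∏ i, q σ (D i)) * (({j | ψ D j ≠ σ j} : Finset J).card : ℝ) =
        ∑ j, ∑ σ : J → Bool, ∑ D : Fin n → Z,
          (∏ i, q σ (D i)) * if ψ D j ≠ σ j then 1 else 0 := by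
      rw [Finset.sum_comm (s := (Finset.univ : Finset J))]
      refine Finset.sum_congr rfl fun σ _ => ?_
      rw [Finset.sum_comm (s := (Finset.univ : Finset J))]
      refine Finset.sum_congr rfl fun D _ => ?_
      rw [← Finset.mul_sum, Finset.sum_boole]
    rw [e]
    refine le_trans (le_of_eq ?_) this
    simp only [Finset.sum_const, Finset.card_univ, nsmul_eq_mul]
    ring
  obtain ⟨σ, -, hσ⟩ := Finset.exists_le_of_sum_le Finset.univ_nonempty htot
  refine ⟨σ, ?_⟩
  -- Reverse Markov: the mean number of mistakes is at least `card J / 8`, while the count is below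
  -- `card J / 16` off `S` and at most `card J` on `S`.
  set S : Finset (Fin n → Z) :=
    {D | (Fintype.card J : ℝ) ≤ 16 * (({j | ψ D j ≠ σ j} : Finset J).card : ℝ)}
  have hsplit : ∑ D : Fin n → Z, (∏ i, q σ (D i)) * (({j | ψ D j ≠ σ j} : Finset J).card : ℝ) ≤
      ∑ D : Fin n → Z, ((∏ i, q σ (D i)) * ((Fintype.card J : ℝ) / 16) +
        if D ∈ S then (∏ i, q σ (D i)) * (Fintype.card J : ℝ) else 0) := by
    refine Finset.sum_le_sum fun D _ => ?_
    have hc : (({j | ψ D j ≠ σ j} : Finset J).card : ℝ) ≤ Fintype.card J := by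
      exact_mod_cast Finset.card_le_univ _
    by_cases hD : D ∈ S
    · rw [if_pos hD]
      nlinarith [mul_le_mul_of_nonneg_left hc (hP σ D), mul_nonneg (hP σ D) hm.le]
    · rw [if_neg hD, add_zero]
      refine mul_le_mul_of_nonneg_left ?_ (hP σ D)
      simp only [S, Finset.mem_filter, Finset.mem_univ, true_and, not_le] at hD
      linarith
  rw [Finset.sum_add_distrib, ← Finset.sum_mul, ← Fintype.sum_pow, hq1, one_pow, one_mul,
    Finset.sum_ite_mem, Finset.univ_inter, ← Finset.sum_mul] at hsplit
  have := hσ.trans hsplit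
  have h3 : (1 / 16 : ℝ) * Fintype.card J ≤ (∑ D ∈ S, ∏ i, q σ (D i)) * Fintype.card J := by
    linarith
  exact le_of_mul_le_mul_right h3 hm

/-! ### Distributions with finitely many atoms -/

theorem sum_dirac_apply_singleton {Z : Type*} [Fintype Z] [MeasurableSpace Z]
    [DiscreteMeasurableSpace Z] (q : Z → ℝ≥0∞) (z : Z) :
    (∑ w, q w • Measure.dirac w : Measure Z) {z} = q z := by
  classical
  simp [Measure.finsetSum_apply, Measure.dirac_apply', Set.indicator_apply, Finset.sum_ite_eq']

section

variable {d M : ℕ} {𝒳 : Set (EuclideanSpace ℝ (Fin d))} {I : Type*}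

/-- The mass function on `I × Fin M` of a pair with first marginal `μ` and conditional
probability `η` at the atoms `x`. -/
def jointMass (x : I → 𝒳) (μ : I → ℝ) (η : Predictor 𝒳 M) (z : I × Fin M) : ℝ :=
  μ z.1 * η.1 (x z.1) z.2

theorem jointMass_nonneg {x : I → 𝒳} {μ : I → ℝ} {η : Predictor 𝒳 M} (hμ : ∀ i, 0 ≤ μ i)
    (z : I × Fin M) : 0 ≤ jointMass x μ η z :=
  mul_nonneg (hμ _) ((η.2.2 _).1 _)

variable [Fintype I]

/-- The measure on `I × Fin M` with mass function `jointMass`. -/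
noncomputable def indexMeasure [MeasurableSpace I] (x : I → 𝒳) (μ : I → ℝ) (η : Predictor 𝒳 M) :
    Measure (I × Fin M) :=
  ∑ z, ENNReal.ofReal (jointMass x μ η z) • Measure.dirac z

/-- The distribution on `𝒳 × Fin M` whose first marginal has mass `μ i` at the atom `x i` and whose
conditional probability is `η`. -/
noncomputable def atomicMeasure [MeasurableSpace I] (x : I → 𝒳) (μ : I → ℝ)
    (η : Predictor 𝒳 M) : Measure (𝒳 × Fin M) :=
  (indexMeasure x μ η).map fun z => (x z.1, z.2)

variable {x : I → 𝒳} {μ : I → ℝ} {η : Predictor 𝒳 M}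

theorem sum_jointMass (hμ1 : ∑ i, μ i = 1) : ∑ z, jointMass x μ η z = 1 := by
  simp only [Fintype.sum_prod_type, jointMass, ← Finset.mul_sum, (η.2.2 _).2, mul_one, hμ1]

theorem measurable_ceLoss_predictor (f : Predictor 𝒳 M) :
    Measurable fun z : 𝒳 × Fin M => ceLoss (f.1 z.1 z.2) :=
  measurable_ceLoss.comp <| measurable_from_prod_countable_left fun m =>
    (measurable_pi_apply m).comp f.2.1

variable [MeasurableSpace I] [DiscreteMeasurableSpace I]

theorem indexMeasure_singleton (z : I × Fin M) :
    indexMeasure x μ η {z} = ENNReal.ofReal (jointMass x μ η z) :=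
  sum_dirac_apply_singleton _ z

theorem isProbabilityMeasure_indexMeasure (hμ : ∀ i, 0 ≤ μ i) (hμ1 : ∑ i, μ i = 1) :
    IsProbabilityMeasure (indexMeasure x μ η) := by
  constructor
  rw [← Finset.coe_univ, ← sum_measure_singleton]
  simp only [indexMeasure_singleton]
  rw [← ENNReal.ofReal_sum_of_nonneg fun z _ => jointMass_nonneg hμ z, sum_jointMass hμ1,
    ENNReal.ofReal_one]

theorem measurable_atom_prod : Measurable fun z : I × Fin M => (x z.1, z.2) :=
  .of_discrete

theorem isProbabilityMeasure_atomicMeasure (hμ : ∀ i, 0 ≤ μ i) (hμ1 : ∑ i, μ i = 1) :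
    IsProbabilityMeasure (atomicMeasure x μ η) :=
  have := isProbabilityMeasure_indexMeasure (x := x) (η := η) hμ hμ1
  Measure.isProbabilityMeasure_map measurable_atom_prod.aemeasurable

theorem lintegral_atomicMeasure {g : 𝒳 × Fin M → ℝ≥0∞} (hg : Measurable g) :
    ∫⁻ z, g z ∂atomicMeasure x μ η =
      ∑ i, ∑ y, g (x i, y) * ENNReal.ofReal (jointMass x μ η (i, y)) := by
  rw [atomicMeasure, lintegral_map hg measurable_atom_prod, lintegral_fintype,
    Fintype.sum_prod_type]
  simp only [indexMeasure_singleton]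

theorem lintegral_fst_atomicMeasure (hμ : ∀ i, 0 ≤ μ i) {g : 𝒳 → ℝ≥0∞} (hg : Measurable g) :
    ∫⁻ z, g z ∂(atomicMeasure x μ η).fst = ∑ i, g (x i) * ENNReal.ofReal (μ i) := by
  rw [Measure.fst, lintegral_map hg measurable_fst,
    lintegral_atomicMeasure (g := fun z => g z.1) (hg.comp measurable_fst)]
  refine Finset.sum_congr rfl fun i _ => ?_
  change ∑ y, g (x i) * _ = _
  rw [← Finset.mul_sum, ← ENNReal.ofReal_sum_of_nonneg fun y _ => jointMass_nonneg hμ _]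
  simp only [jointMass, ← Finset.mul_sum, (η.2.2 _).2, mul_one]

theorem fst_atomicMeasure_apply (hμ : ∀ i, 0 ≤ μ i) {B : Set 𝒳} (hB : MeasurableSet B) :
    (atomicMeasure x μ η).fst B = ∑ i, B.indicator 1 (x i) * ENNReal.ofReal (μ i) := by
  rw [← lintegral_indicator_one hB,
    lintegral_fst_atomicMeasure hμ (measurable_one.indicator hB)]

theorem isCondProb_atomicMeasure (hμ : ∀ i, 0 ≤ μ i) :
    IsCondProb (atomicMeasure x μ η) η := by
  intro B hB m
  have hBm : MeasurableSet (B ×ˢ {m} : Set (𝒳 × Fin M)) := hB.prod (measurableSet_singleton m)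
  have hη : Measurable fun x => ENNReal.ofReal (η.1 x m) :=
    ((measurable_pi_apply m).comp η.2.1).ennreal_ofReal
  rw [← lintegral_indicator hB, lintegral_fst_atomicMeasure hμ (hη.indicator hB),
    ← lintegral_indicator_one hBm, lintegral_atomicMeasure (measurable_one.indicator hBm)]
  refine Finset.sum_congr rfl fun i _ => ?_
  rw [Finset.sum_eq_single m]
  · by_cases h : x i ∈ B
    · simp [h, jointMass, ENNReal.ofReal_mul (hμ i), mul_comm]
    · simp [h]
  · intro y _ hy
    simp [hy]
  · simp

/-- The excess risk is at least the weighted squared Hellinger distance in one class. -/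
theorem le_ceExcessRisk_atomicMeasure (hμ : ∀ i, 0 ≤ μ i) (f : Predictor 𝒳 M) (k : Fin M) :
    ENNReal.ofReal (∑ i, μ i * (√(η.1 (x i) k) - √(f.1 (x i) k)) ^ 2) ≤
      ceExcessRisk (atomicMeasure x μ η) f := by
  have hrisk : ∀ g : Predictor 𝒳 M, ceRisk (atomicMeasure x μ η) g =
      ∑ i, ENNReal.ofReal (μ i) * ∑ y, ENNReal.ofReal (η.1 (x i) y) * ceLoss (g.1 (x i) y) := by
    intro g
    rw [ceRisk, lintegral_atomicMeasure (measurable_ceLoss_predictor g)]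
    refine Finset.sum_congr rfl fun i _ => ?_
    rw [Finset.mul_sum]
    refine Finset.sum_congr rfl fun y _ => ?_
    rw [jointMass, ENNReal.ofReal_mul (hμ i)]
    ring
  have hfin : ceRisk (atomicMeasure x μ η) η ≠ ⊤ := by
    rw [hrisk]
    exact ENNReal.sum_ne_top.2 fun i _ => ENNReal.mul_ne_top ENNReal.ofReal_ne_top
      (ENNReal.sum_ne_top.2 fun y _ => mul_ceLoss_self_ne_top _)
  have hle : ceRisk (atomicMeasure x μ η) η +
      ENNReal.ofReal (∑ i, μ i * (√(η.1 (x i) k) - √(f.1 (x i) k)) ^ 2) ≤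
      ceRisk (atomicMeasure x μ η) f := by
    rw [hrisk, hrisk, ENNReal.ofReal_sum_of_nonneg fun i _ => mul_nonneg (hμ i) (sq_nonneg _),
      ← Finset.sum_add_distrib]
    refine Finset.sum_le_sum fun i _ => ?_
    rw [ENNReal.ofReal_mul (hμ i), ← mul_add]
    gcongr
    exact sum_mul_ceLoss_add_le (η.2.2 _) (f.2.2 _) k
  -- Optimality of `η` is not needed: as a competitor it bounds the infimum from above.
  calc _ ≤ ceRisk (atomicMeasure x μ η) f - ceRisk (atomicMeasure x μ η) η :=
        ENNReal.le_sub_of_add_le_left hfin hle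
    _ ≤ _ := tsub_le_tsub_left (iInf_le _ η) _

/-- Transfers finite sums to the outer measure of an arbitrary `S`, so the learner need not be
measurable in the sample. -/
theorem le_pi_atomicMeasure (hμ : ∀ i, 0 ≤ μ i) (hμ1 : ∑ i, μ i = 1) {n : ℕ}
    (S : Set (Fin n → 𝒳 × Fin M)) (T : Finset (Fin n → I × Fin M))
    (hT : ∀ D ∈ T, (fun i => (x (D i).1, (D i).2)) ∈ S) :
    ENNReal.ofReal (∑ D ∈ T, ∏ i, jointMass x μ η (D i)) ≤
      Measure.pi (fun _ : Fin n => atomicMeasure x μ η) S := by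
  have h1 := isProbabilityMeasure_indexMeasure (x := x) (η := η) hμ hμ1
  have h2 := isProbabilityMeasure_atomicMeasure (x := x) (η := η) hμ hμ1
  have hmap := Measure.pi_map_pi (μ := fun _ : Fin n => indexMeasure x μ η)
    (f := fun _ z => (x z.1, z.2)) (hμ := fun _ => by
      change SigmaFinite (atomicMeasure x μ η); infer_instance)
    fun _ => measurable_atom_prod.aemeasurable
  calc _ = ∑ D ∈ T, Measure.pi (fun _ : Fin n => indexMeasure x μ η) {D} := by
        rw [ENNReal.ofReal_sum_of_nonneg fun D _ =>
          Finset.prod_nonneg fun i _ => jointMass_nonneg hμ _]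
        refine Finset.sum_congr rfl fun D _ => ?_
        rw [Measure.pi_singleton, ENNReal.ofReal_prod_of_nonneg fun i _ => jointMass_nonneg hμ _]
        simp only [indexMeasure_singleton]
    _ = Measure.pi (fun _ : Fin n => indexMeasure x μ η) T := sum_measure_singleton
    _ ≤ Measure.pi (fun _ : Fin n => indexMeasure x μ η)
          ((fun D i => (x (D i).1, (D i).2)) ⁻¹' S) := measure_mono fun D hD => hT D hD
    _ ≤ _ := Measure.le_map_apply (by fun_prop) _
    _ = _ := by rw [hmap]; rfl

end

/-! ### From indistinguishable levels to excess risk -/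

/-- Concavity of the square root: `[t - hi, t - lo]` has the length of `[lo, hi]` and lies to its
right. Thus the compensating class adds no more Hellinger distance than class `k`. -/
theorem sq_sqrt_sub_sqrt_le {lo hi t : ℝ} (hlo : 0 ≤ lo) (hle : lo ≤ hi) (ht : 2 * hi ≤ t) :
    (√(t - lo) - √(t - hi)) ^ 2 ≤ (√hi - √lo) ^ 2 := by
  have h1 : 0 ≤ √(t - lo) - √(t - hi) := sub_nonneg.2 (Real.sqrt_le_sqrt (by linarith))
  have h2 : 0 ≤ √hi - √lo := sub_nonneg.2 (Real.sqrt_le_sqrt hle)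
  refine pow_le_pow_left₀ h1 ?_ 2
  have h3 : √lo ≤ √(t - hi) := Real.sqrt_le_sqrt (by linarith)
  have h4 : √hi ≤ √(t - lo) := Real.sqrt_le_sqrt (by linarith)
  have e1 := Real.sq_sqrt hlo
  have e2 := Real.sq_sqrt (hlo.trans hle)
  have e3 := Real.sq_sqrt (show 0 ≤ t - hi by linarith)
  have e4 := Real.sq_sqrt (show 0 ≤ t - lo by linarith)
  by_contra! h
  have h5 := Real.sqrt_nonneg lo
  have h6 := Real.sqrt_nonneg hi
  nlinarith [mul_nonneg h2 (sub_nonneg.2 (add_le_add h3 h4)),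
    mul_nonneg (sub_nonneg.2 h.le) (add_nonneg h5 h6)]

section

variable {d M : ℕ} {𝒳 : Set (EuclideanSpace ℝ (Fin d))} {J : Type*} [Fintype J]

/-- Mass `W` spread evenly over `J`, and the remaining mass `1 - W` at `none`. -/
noncomputable def spreadMass (J : Type*) [Fintype J] (W : ℝ) : Option J → ℝ
  | none => 1 - W
  | some _ => W / Fintype.card J

theorem spreadMass_nonneg {W : ℝ} (hW : W ∈ Icc (0 : ℝ) 1) : ∀ i, 0 ≤ spreadMass J W i
  | none => sub_nonneg.2 hW.2
  | some _ => div_nonneg hW.1 (Nat.cast_nonneg _)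

theorem sum_spreadMass [Nonempty J] (W : ℝ) : ∑ i, spreadMass J W i = 1 := by
  have : (Fintype.card J : ℝ) ≠ 0 := by exact_mod_cast Fintype.card_ne_zero
  simp only [Fintype.sum_option, spreadMass, Finset.sum_const, Finset.card_univ, nsmul_eq_mul]
  field_simp
  ring

variable [DecidableEq J]

/-- A flip affects only atom `j`, and there only the classes `k` and `l`, each contributing at most
`(√hi - √lo) ^ 2`. -/
theorem sum_sq_sqrt_jointMass_sub_le {x : Option J → 𝒳} {W lo hi t : ℝ} (hW : W ∈ Icc (0 : ℝ) 1)
    (hlo : 0 ≤ lo) (hle : lo ≤ hi) (ht : 2 * hi ≤ t)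
    {η : (J → Bool) → Predictor 𝒳 M} {k l : Fin M}
    (hη : ∀ σ j, (η σ).1 (x (some j)) k = if σ j then hi else lo)
    (hηl : ∀ σ j, (η σ).1 (x (some j)) l = t - (η σ).1 (x (some j)) k)
    (hηm : ∀ σ σ' j m, m ≠ k → m ≠ l → (η σ).1 (x (some j)) m = (η σ').1 (x (some j)) m)
    (hη0 : ∀ σ σ', (η σ).1 (x none) = (η σ').1 (x none)) (σ : J → Bool) (j : J) :
    ∑ z, (√(jointMass x (spreadMass J W) (η σ) z) -
        √(jointMass x (spreadMass J W) (η (Function.update σ j (!σ j))) z)) ^ 2 ≤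
      2 * (W / Fintype.card J) * (√hi - √lo) ^ 2 := by
  set σ' := Function.update σ j (!σ j) with hσ'
  set w := W / Fintype.card J with hw
  have hw0 : 0 ≤ w := div_nonneg hW.1 (Nat.cast_nonneg _)
  have hterm : ∀ i y, (√(jointMass x (spreadMass J W) (η σ) (i, y)) -
      √(jointMass x (spreadMass J W) (η σ') (i, y))) ^ 2 =
      spreadMass J W i * (√((η σ).1 (x i) y) - √((η σ').1 (x i) y)) ^ 2 := by
    intro i y
    simp only [jointMass]
    rw [Real.sqrt_mul (spreadMass_nonneg hW i), Real.sqrt_mul (spreadMass_nonneg hW i), ← mul_sub,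
      mul_pow, Real.sq_sqrt (spreadMass_nonneg hW i)]
  have hother : ∀ i, i ≠ j → ∀ y, (η σ).1 (x (some i)) y = (η σ').1 (x (some i)) y := by
    intro i hi y
    have hk : (η σ).1 (x (some i)) k = (η σ').1 (x (some i)) k := by
      rw [hη, hη, hσ', Function.update_of_ne hi]
    by_cases hyk : y = k
    · rw [hyk, hk]
    by_cases hyl : y = l
    · rw [hyl, hηl, hηl, hk]
    · exact hηm _ _ _ _ hyk hyl
  have hk : (√((η σ).1 (x (some j)) k) - √((η σ').1 (x (some j)) k)) ^ 2 = (√hi - √lo) ^ 2 := by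
    rw [hη, hη, hσ', Function.update_self]
    cases σ j <;> simp [sub_sq_comm]
  have hl : (√((η σ).1 (x (some j)) l) - √((η σ').1 (x (some j)) l)) ^ 2 ≤
      (√hi - √lo) ^ 2 := by
    rw [hηl, hηl, hη, hη, hσ', Function.update_self]
    have := sq_sqrt_sub_sqrt_le hlo hle ht
    cases σ j
    · simpa using this
    · rw [sub_sq_comm] at this
      simpa using this
  have hcell : ∑ y, (√((η σ).1 (x (some j)) y) - √((η σ').1 (x (some j)) y)) ^ 2 ≤
      2 * (√hi - √lo) ^ 2 := by
    calc _ ≤ ∑ y, ((if y = k then (√hi - √lo) ^ 2 else 0) +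
          if y = l then (√hi - √lo) ^ 2 else 0) := by
          refine Finset.sum_le_sum fun y _ => ?_
          have := sq_nonneg (√hi - √lo)
          by_cases hyk : y = k
          · rw [hyk, hk, if_pos rfl]
            split_ifs <;> linarith
          by_cases hyl : y = l
          · rw [hyl, if_pos rfl]
            split_ifs <;> linarith
          · rw [hηm σ σ' j y hyk hyl, if_neg hyk, if_neg hyl]
            simp
      _ = _ := by
          rw [Finset.sum_add_distrib]
          simp
          ring
  rw [Fintype.sum_prod_type]
  simp only [hterm, ← Finset.mul_sum]
  rw [Fintype.sum_option, hη0 σ σ', Finset.sum_eq_single j]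
  · simp only [sub_self, ne_eq, OfNat.ofNat_ne_zero, not_false_eq_true, zero_pow,
      Finset.sum_const_zero, mul_zero, zero_add, spreadMass]
    calc _ ≤ w * (2 * (√hi - √lo) ^ 2) := mul_le_mul_of_nonneg_left hcell hw0
      _ = _ := by ring
  · intro i _ hi
    simp [hother i hi]
  · simp

/-- If the class `k` probabilities at the `Fintype.card J` atoms independently take one of two
levels that `n` observations cannot tell apart, then every learner has large excess risk. -/
theorem exists_le_prob_ceExcessRisk [Nonempty J] [MeasurableSpace (Option J)]
    [DiscreteMeasurableSpace (Option J)] {x : Option J → 𝒳} {W lo hi t : ℝ}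
    (hW : W ∈ Icc (0 : ℝ) 1) (hlo : 0 ≤ lo) (hle : lo ≤ hi) (ht : 2 * hi ≤ t)
    {η : (J → Bool) → Predictor 𝒳 M} {k l : Fin M}
    (hη : ∀ σ j, (η σ).1 (x (some j)) k = if σ j then hi else lo)
    (hηl : ∀ σ j, (η σ).1 (x (some j)) l = t - (η σ).1 (x (some j)) k)
    (hηm : ∀ σ σ' j m, m ≠ k → m ≠ l → (η σ).1 (x (some j)) m = (η σ').1 (x (some j)) m)
    (hη0 : ∀ σ σ', (η σ).1 (x none) = (η σ').1 (x none)) {n : ℕ}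
    (hn : 4 * n * (W * (√hi - √lo) ^ 2) ≤ Fintype.card J)
    (A : (Fin n → 𝒳 × Fin M) → Predictor 𝒳 M) :
    ∃ σ : J → Bool, ENNReal.ofReal (1 / 16) ≤
      Measure.pi (fun _ : Fin n => atomicMeasure x (spreadMass J W) (η σ))
        {D | ENNReal.ofReal (W * (√hi - √lo) ^ 2 / 64) ≤
          ceExcessRisk (atomicMeasure x (spreadMass J W) (η σ)) (A D)} := by
  have hm : (0 : ℝ) < Fintype.card J := by exact_mod_cast Fintype.card_pos
  have hμ := spreadMass_nonneg (J := J) hW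
  have hμ1 := sum_spreadMass (J := J) W
  have hs : 0 ≤ √hi - √lo := sub_nonneg.2 (Real.sqrt_le_sqrt hle)
  set s := √hi - √lo with hsdef
  set smp : (Fin n → Option J × Fin M) → Fin n → 𝒳 × Fin M :=
    fun D i => (x (D i).1, (D i).2) with hsmp
  obtain ⟨σ, hσ⟩ := exists_le_prob_mistakes
    (fun σ => jointMass x (spreadMass J W) (η σ)) (fun σ z => jointMass_nonneg hμ z)
    (fun σ => sum_jointMass hμ1) n (fun σ j => by
      have h1 := sum_sq_sqrt_jointMass_sub_le hW hlo hle ht hη hηl hηm hη0 σ j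
      refine (mul_le_mul_of_nonneg_left h1 (Nat.cast_nonneg n)).trans ?_
      calc (n : ℝ) * (2 * (W / Fintype.card J) * s ^ 2) =
            4 * n * (W * s ^ 2) / Fintype.card J / 2 := by ring
        _ ≤ 1 / 2 := by
            have := (div_le_one hm).2 hn
            linarith)
    -- The sign is read off by comparing `√f` with the midpoint of `√lo` and `√hi`; a wrong reading
    -- puts `√f` at distance at least `s / 2` from the truth.
    (fun D j => decide ((√hi + √lo) / 2 < √((A (smp D)).1 (x (some j)) k)))
  refine ⟨σ, (ENNReal.ofReal_le_ofReal hσ).trans (le_pi_atomicMeasure hμ hμ1 _ _ ?_)⟩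
  intro D hD
  simp only [Finset.mem_filter, Finset.mem_univ, true_and] at hD
  refine le_trans (ENNReal.ofReal_le_ofReal ?_) (le_ceExcessRisk_atomicMeasure hμ _ k)
  set f := A (smp D)
  set mist : Finset J :=
    {j | decide ((√hi + √lo) / 2 < √(f.1 (x (some j)) k)) ≠ σ j}
  have hw0 : 0 ≤ W / Fintype.card J := div_nonneg hW.1 hm.le
  calc W * s ^ 2 / 64 = (W / Fintype.card J * (s ^ 2 / 4)) * (Fintype.card J / 16) := by
        field_simp; ring
    _ ≤ (W / Fintype.card J * (s ^ 2 / 4)) * mist.card := by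
        refine mul_le_mul_of_nonneg_left (by linarith) (by positivity)
    _ = ∑ j ∈ mist, W / Fintype.card J * (s ^ 2 / 4) := by
        rw [Finset.sum_const, nsmul_eq_mul]; ring
    _ ≤ ∑ j ∈ mist, W / Fintype.card J *
          (√((η σ).1 (x (some j)) k) - √(f.1 (x (some j)) k)) ^ 2 := by
        refine Finset.sum_le_sum fun j hj => mul_le_mul_of_nonneg_left ?_ hw0
        simp only [mist, Finset.mem_filter, Finset.mem_univ, true_and] at hj
        rw [hη]
        have e : s ^ 2 / 4 = (s / 2) ^ 2 := by ring
        rw [e]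
        cases h : σ j
        · rw [h] at hj
          have h' : (√hi + √lo) / 2 < √(f.1 (x (some j)) k) := by simpa using hj
          rw [← neg_sq (√(if false = true then hi else lo) - _)]
          refine pow_le_pow_left₀ (by linarith) ?_ 2
          simp only [Bool.false_eq_true, if_false]
          linarith
        · rw [h] at hj
          have h' : √(f.1 (x (some j)) k) ≤ (√hi + √lo) / 2 := by simpa using hj
          refine pow_le_pow_left₀ (by linarith) ?_ 2
          simp only [if_true]
          linarith
    _ ≤ ∑ j, W / Fintype.card J *
          (√((η σ).1 (x (some j)) k) - √(f.1 (x (some j)) k)) ^ 2 :=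
        Finset.sum_le_sum_of_subset_of_nonneg (Finset.subset_univ _)
          fun j _ _ => mul_nonneg hw0 (sq_nonneg _)
    _ ≤ _ := by
        rw [Fintype.sum_option]
        exact le_add_of_nonneg_left (mul_nonneg (hμ none) (sq_nonneg _))

end

/-! ### Truncated distance functions as Hölder bumps -/

theorem min_one_le_rpow {t α : ℝ} (ht : 0 ≤ t) (hα : α ∈ Icc (0 : ℝ) 1) : min 1 t ≤ t ^ α := by
  rcases le_total t 1 with h | h
  · rw [min_eq_right h]
    rcases ht.eq_or_lt with rfl | h0
    · exact Real.rpow_nonneg le_rfl _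
    · simpa using Real.rpow_le_rpow_of_exponent_ge h0 h hα.2
  · rw [min_eq_left h]
    exact Real.one_le_rpow h hα.1

/-- The truncation is `1 / r`-Lipschitz with values in `[0, 1]`, so its increments are at most `min
1 (dist y' y / r)`. -/
theorem abs_min_one_infDist_div_sub_le {E : Type*} [PseudoMetricSpace E] (S : Set E)
    {r α : ℝ} (hr : 0 < r) (hα : α ∈ Icc (0 : ℝ) 1) (y y' : E) :
    |min 1 (Metric.infDist y' S / r) - min 1 (Metric.infDist y S / r)| ≤
      dist y' y ^ α / r ^ α := by
  have h0 : ∀ z, 0 ≤ min 1 (Metric.infDist z S / r) := fun z =>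
    le_min zero_le_one (div_nonneg Metric.infDist_nonneg hr.le)
  have h1 : ∀ z, min 1 (Metric.infDist z S / r) ≤ 1 := fun z => min_le_left _ _
  rw [← Real.div_rpow dist_nonneg hr.le]
  refine le_trans (le_min ?_ ?_) (min_one_le_rpow (div_nonneg dist_nonneg hr.le) hα)
  · rw [abs_le]
    constructor <;> linarith [h0 y, h0 y', h1 y, h1 y']
  · have hd : |Metric.infDist y' S - Metric.infDist y S| ≤ dist y' y := by
      rw [abs_le]
      have a1 := Metric.infDist_le_infDist_add_dist (s := S) (x := y) (y := y')
      have a2 := Metric.infDist_le_infDist_add_dist (s := S) (x := y') (y := y)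
      rw [dist_comm y y'] at a1
      constructor <;> linarith
    calc _ ≤ |Metric.infDist y' S / r - Metric.infDist y S / r| := by
          simpa using abs_min_sub_min_le_max 1 (Metric.infDist y' S / r) 1 (Metric.infDist y S / r)
      _ = |Metric.infDist y' S - Metric.infDist y S| / r := by
          rw [← sub_div, abs_div, abs_of_pos hr]
      _ ≤ _ := by gcongr

theorem min_one_infDist_div_eq_one {E : Type*} [PseudoMetricSpace E] {S : Set E}
    (hS : S.Nonempty) {r : ℝ} (hr : 0 < r) {y : E} (h : ∀ z ∈ S, r ≤ dist y z) :
    min 1 (Metric.infDist y S / r) = 1 :=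
  min_eq_left <| (one_le_div hr).2 <| (Metric.le_infDist hS).2 fun {z} hz => h z hz

theorem min_one_infDist_div_eq_zero {E : Type*} [PseudoMetricSpace E] {S : Set E} {r : ℝ} {y : E}
    (h : y ∈ S) : min 1 (Metric.infDist y S / r) = 0 := by
  rw [Metric.infDist_zero_of_mem h, zero_div, min_eq_right zero_le_one]

/-! ### Two-class perturbations and membership in the class -/

section

variable {d M : ℕ} {𝒳 : Set (EuclideanSpace ℝ (Fin d))}

/-- The predictor with probability `u` for class `k`, `2 / M - u` for class `l` and `1 / M` for
every other class. -/
noncomputable def twoClassPredictor (hM : 2 ≤ M) {k l : Fin M} (hkl : k ≠ l) (u : 𝒳 → ℝ)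
    (hu : Measurable u) (hu0 : ∀ y, 0 ≤ u y) (hu1 : ∀ y, u y ≤ 1 / M) : Predictor 𝒳 M :=
  ⟨fun y m => 1 / M + (u y - 1 / M) * ((if m = k then 1 else 0) - if m = l then 1 else 0),
    measurable_pi_lambda _ fun m => by fun_prop, fun y => by
      have hM0 : (0 : ℝ) < M := by exact_mod_cast (by omega : 0 < M)
      have hM1 : (0 : ℝ) < 1 / M := by positivity
      constructor
      · intro m
        have := hu0 y
        have := hu1 y
        by_cases h : m = k
        · have : m ≠ l := fun h' => hkl (h.symm.trans h')
          simp only [h, hkl, if_true, if_false]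
          linarith
        · simp only [h, if_false]
          split_ifs <;> linarith
      · rw [Finset.sum_add_distrib, ← Finset.mul_sum, Finset.sum_sub_distrib]
        simp [hM0.ne']⟩

variable (hM : 2 ≤ M) {k l : Fin M} (hkl : k ≠ l) {u : 𝒳 → ℝ}
    (hu : Measurable u) (hu0 : ∀ y, 0 ≤ u y) (hu1 : ∀ y, u y ≤ 1 / M)

theorem twoClassPredictor_apply_left (y : 𝒳) :
    (twoClassPredictor hM hkl u hu hu0 hu1).1 y k = u y := by
  simp [twoClassPredictor, hkl]

theorem twoClassPredictor_apply_right (y : 𝒳) :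
    (twoClassPredictor hM hkl u hu hu0 hu1).1 y l = 2 / M - u y := by
  simp only [twoClassPredictor, hkl.symm, if_true, if_false]
  ring

theorem twoClassPredictor_apply_of_ne (y : 𝒳) {m : Fin M} (hk : m ≠ k) (hl : m ≠ l) :
    (twoClassPredictor hM hkl u hu hu0 hu1).1 y m = 1 / M := by
  simp [twoClassPredictor, hk, hl]

theorem le_twoClassPredictor_apply (y : 𝒳) {m : Fin M} (hk : m ≠ k) :
    1 / M ≤ (twoClassPredictor hM hkl u hu hu0 hu1).1 y m := by
  by_cases hl : m = l
  · rw [hl, twoClassPredictor_apply_right]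
    have := hu1 y
    have e : (2 : ℝ) / M = 1 / M + 1 / M := by ring
    linarith
  · rw [twoClassPredictor_apply_of_ne _ _ _ _ _ _ hk hl]

theorem abs_twoClassPredictor_sub_le (y y' : 𝒳) (m : Fin M) :
    |(twoClassPredictor hM hkl u hu hu0 hu1).1 y' m -
      (twoClassPredictor hM hkl u hu hu0 hu1).1 y m| ≤ |u y' - u y| := by
  by_cases hk : m = k
  · rw [hk, twoClassPredictor_apply_left, twoClassPredictor_apply_left]
  by_cases hl : m = l
  · rw [hl, twoClassPredictor_apply_right, twoClassPredictor_apply_right, abs_sub_comm]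
    apply le_of_eq
    congr 1
    ring
  · rw [twoClassPredictor_apply_of_ne _ _ _ _ _ _ hk hl,
      twoClassPredictor_apply_of_ne _ _ _ _ _ _ hk hl]
    simp

/-- For class `k`, no atom lies below `lo`, and only the grid atoms, of mass `W ≤ lo ^ β`, can lie
below `lo + v`. For larger `t`, and for the other classes once `t ≥ 1 / M`, the bound exceeds one.
-/
theorem atomicMeasure_mem_holderSmallValueClass {J : Type*} [Fintype J] [Nonempty J]
    [MeasurableSpace (Option J)] [DiscreteMeasurableSpace (Option J)] {x : Option J → 𝒳}
    {W α β cα cβ lo v : ℝ} (hW : W ∈ Icc (0 : ℝ) 1) (hβ : 0 ≤ β)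
    (hlo : 0 < lo) (hv : 0 < v) (hcβ : 1 ≤ cβ)
    (hhol : ∀ y y' : 𝒳, |u y' - u y| ≤ cα * ‖(y' : EuclideanSpace ℝ (Fin d)) - y‖ ^ α)
    (hx : ∀ j, lo ≤ u (x (some j))) (hx0 : lo + v ≤ u (x none))
    (hWlo : W ≤ lo ^ β) (hvβ : 1 ≤ cβ * v ^ β) (hMβ : 1 ≤ cβ * (1 / M : ℝ) ^ β) :
    atomicMeasure x (spreadMass J W) (twoClassPredictor hM hkl u hu hu0 hu1) ∈
      holderSmallValueClass 𝒳 M α β cα cβ := by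
  set η := twoClassPredictor hM hkl u hu hu0 hu1 with hη
  have hμ := spreadMass_nonneg (J := J) hW
  have hμ1 := sum_spreadMass (J := J) W
  have hprob := isProbabilityMeasure_atomicMeasure (x := x) (η := η) hμ hμ1
  have hM0 : (0 : ℝ) < 1 / M := by
    have : (0 : ℝ) < M := by exact_mod_cast (by omega : 0 < M)
    positivity
  refine ⟨hprob, η, isCondProb_atomicMeasure hμ,
    fun m y y' => (abs_twoClassPredictor_sub_le hM hkl hu hu0 hu1 y y' m).trans (hhol y y'), ?_⟩
  intro m t ht
  have hB : MeasurableSet {y : 𝒳 | η.1 y m ≤ t} :=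
    measurableSet_le ((measurable_pi_apply m).comp η.2.1) measurable_const
  have hbig : ∀ a, 0 < a → a ≤ t → 1 ≤ cβ * a ^ β →
      (atomicMeasure x (spreadMass J W) η).fst {y : 𝒳 | η.1 y m ≤ t} ≤
        ENNReal.ofReal (cβ * t ^ β) := by
    intro a ha hat h1
    refine prob_le_one.trans ?_
    rw [← ENNReal.ofReal_one]
    refine ENNReal.ofReal_le_ofReal (h1.trans ?_)
    exact mul_le_mul_of_nonneg_left (Real.rpow_le_rpow ha.le hat hβ) (by linarith)
  by_cases hk : m = k
  · have hval : ∀ y, η.1 y m = u y := fun y => by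
      rw [hk, hη, twoClassPredictor_apply_left]
    rcases le_or_gt (lo + v) t with h | h
    · exact hbig v hv (by linarith) hvβ
    have hnone : x none ∉ {y : 𝒳 | η.1 y m ≤ t} := by
      rw [mem_ofPred_eq, hval]; linarith
    rw [fst_atomicMeasure_apply hμ hB, Fintype.sum_option, indicator_of_notMem hnone, zero_mul,
      zero_add]
    rcases le_or_gt lo t with h' | h'
    · calc _ ≤ ∑ j : J, ENNReal.ofReal (spreadMass J W (some j)) := by
            refine Finset.sum_le_sum fun j _ => ?_
            refine mul_le_of_le_one_left zero_le ?_
            exact indicator_le_self' (f := (1 : 𝒳 → ℝ≥0∞)) (fun _ _ => zero_le) _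
        _ = ENNReal.ofReal W := by
            rw [← ENNReal.ofReal_sum_of_nonneg fun j _ => hμ _]
            rw [Fintype.sum_option] at hμ1
            congr 1
            have : spreadMass J W none = 1 - W := rfl
            linarith
        _ ≤ _ := by
            refine ENNReal.ofReal_le_ofReal (hWlo.trans ?_)
            have h1 : lo ^ β ≤ t ^ β := Real.rpow_le_rpow hlo.le h' hβ
            have h2 : 0 ≤ t ^ β := Real.rpow_nonneg ht.1.le _
            nlinarith
    · refine le_trans (le_of_eq (Finset.sum_eq_zero fun j _ => ?_)) zero_le
      have : x (some j) ∉ {y : 𝒳 | η.1 y m ≤ t} := by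
        rw [mem_ofPred_eq, hval]; linarith [hx j]
      rw [indicator_of_notMem this, zero_mul]
  · rcases le_or_gt (1 / M : ℝ) t with h | h
    · exact hbig _ hM0 h hMβ
    · refine le_trans (le_of_eq ?_) zero_le
      have : {y : 𝒳 | η.1 y m ≤ t} = ∅ := by
        ext y
        simp only [mem_ofPred_eq, mem_empty_iff_false, iff_false, not_le]
        exact h.trans_le (le_twoClassPredictor_apply hM hkl hu hu0 hu1 y hk)
      rw [this, measure_empty]

end

/-- The lower bound on a configuration of separated points. -/
theorem exists_mem_holderSmallValueClass_le_prob {d M : ℕ} {𝒳 : Set (EuclideanSpace ℝ (Fin d))}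
    (hM : 2 ≤ M) {J : Type*} [Fintype J] [Nonempty J] {x : Option J → 𝒳}
    {W α β cα cβ lo hi v h ρ : ℝ} (hα : α ∈ Icc (0 : ℝ) 1) (hβ : 0 ≤ β) (hW : W ∈ Icc (0 : ℝ) 1)
    (hlo : 0 < lo) (hle : lo ≤ hi) (hv : 0 < v) (hhiv : hi + v ≤ 1 / M) (hcβ : 1 ≤ cβ)
    (hWlo : W ≤ lo ^ β) (hvβ : 1 ≤ cβ * v ^ β) (hMβ : 1 ≤ cβ * (1 / M : ℝ) ^ β)
    (hh : 0 < h) (hρ : 0 < ρ) (hhρ : h ≤ ρ)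
    (hsep : ∀ i j : J, i ≠ j → h ≤ dist (x (some i)) (x (some j)))
    (hsep0 : ∀ j : J, ρ ≤ dist (x none) (x (some j)))
    (hhol : hi - lo ≤ cα / 2 * h ^ α) (hholv : v ≤ cα / 2 * ρ ^ α) {n : ℕ}
    (hn : 4 * n * (W * (√hi - √lo) ^ 2) ≤ Fintype.card J)
    (A : (Fin n → 𝒳 × Fin M) → Predictor 𝒳 M) :
    ∃ P ∈ holderSmallValueClass 𝒳 M α β cα cβ, ENNReal.ofReal (1 / 16) ≤
      Measure.pi (fun _ : Fin n => P)
        {D | ENNReal.ofReal (W * (√hi - √lo) ^ 2 / 64) ≤ ceExcessRisk P (A D)} := by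
  classical
  let _ : MeasurableSpace (Option J) := ⊤
  have : DiscreteMeasurableSpace (Option J) := ⟨fun _ => trivial⟩
  set k : Fin M := ⟨0, by omega⟩ with hk
  set l : Fin M := ⟨1, by omega⟩ with hl
  have hkl : k ≠ l := by simp [hk, hl]
  set S : Set 𝒳 := range fun j => x (some j) with hS
  -- Including `x none` keeps the set nonempty even if all signs are `true` (`infDist` to the empty
  -- set is zero), and makes the value at `x none` independent of `σ`.
  set S0 : (J → Bool) → Set 𝒳 := fun σ => insert (x none) ((fun j => x (some j)) '' {j | σ j = false})
    with hS0
  -- The first bump encodes the signs at scale `h`; the second lifts the remote atom by `v`. Each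
  -- uses half of the Hölder constant.
  set u : (J → Bool) → 𝒳 → ℝ := fun σ y => lo + (hi - lo) * min 1 (Metric.infDist y (S0 σ) / h) +
    v * min 1 (Metric.infDist y S / ρ) with hu_def
  have hmin0 : ∀ (T : Set 𝒳) (y : 𝒳) (r : ℝ), 0 < r → 0 ≤ min 1 (Metric.infDist y T / r) :=
    fun T y r hr => le_min zero_le_one (div_nonneg Metric.infDist_nonneg hr.le)
  have hulo : ∀ σ y, lo ≤ u σ y := fun σ y => by
    have h1 := mul_nonneg (sub_nonneg.2 hle) (hmin0 (S0 σ) y h hh)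
    have h2 := mul_nonneg hv.le (hmin0 S y ρ hρ)
    simp only [hu_def]; linarith
  have hu0 : ∀ σ y, 0 ≤ u σ y := fun σ y => hlo.le.trans (hulo σ y)
  have hu1 : ∀ σ y, u σ y ≤ 1 / M := fun σ y => by
    have h1 := mul_le_mul_of_nonneg_left (min_le_left 1 (Metric.infDist y (S0 σ) / h))
      (sub_nonneg.2 hle)
    have h2 := mul_le_mul_of_nonneg_left (min_le_left 1 (Metric.infDist y S / ρ)) hv.le
    simp only [hu_def]; linarith
  have hum : ∀ σ, Measurable (u σ) := fun σ => by
    refine Continuous.measurable ?_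
    have h1 := Metric.continuous_infDist_pt (S0 σ)
    have h2 := Metric.continuous_infDist_pt S
    fun_prop
  have huhol : ∀ σ, ∀ y y' : 𝒳,
      |u σ y' - u σ y| ≤ cα * ‖(y' : EuclideanSpace ℝ (Fin d)) - y‖ ^ α := by
    intro σ y y'
    have hnn : (0 : ℝ) ≤ ‖(y' : EuclideanSpace ℝ (Fin d)) - y‖ ^ α :=
      Real.rpow_nonneg (norm_nonneg _) _
    have hd : dist y' y = ‖(y' : EuclideanSpace ℝ (Fin d)) - y‖ := by
      rw [Subtype.dist_eq, dist_eq_norm]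
    have h1 := abs_min_one_infDist_div_sub_le (S0 σ) hh hα y y'
    have h2 := abs_min_one_infDist_div_sub_le S hρ hα y y'
    rw [hd] at h1 h2
    have b1 : (hi - lo) * (‖(y' : EuclideanSpace ℝ (Fin d)) - y‖ ^ α / h ^ α) ≤
        cα / 2 * ‖(y' : EuclideanSpace ℝ (Fin d)) - y‖ ^ α := by
      have := Real.rpow_pos_of_pos hh α
      rw [mul_div_left_comm, mul_comm]
      exact mul_le_mul_of_nonneg_right ((div_le_iff₀ this).2 hhol) hnn
    have b2 : v * (‖(y' : EuclideanSpace ℝ (Fin d)) - y‖ ^ α / ρ ^ α) ≤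
        cα / 2 * ‖(y' : EuclideanSpace ℝ (Fin d)) - y‖ ^ α := by
      have := Real.rpow_pos_of_pos hρ α
      rw [mul_div_left_comm, mul_comm]
      exact mul_le_mul_of_nonneg_right ((div_le_iff₀ this).2 hholv) hnn
    have e : u σ y' - u σ y =
        (hi - lo) * (min 1 (Metric.infDist y' (S0 σ) / h) -
          min 1 (Metric.infDist y (S0 σ) / h)) +
        v * (min 1 (Metric.infDist y' S / ρ) - min 1 (Metric.infDist y S / ρ)) := by
      simp only [hu_def]; ring
    rw [e]
    refine (abs_add_le _ _).trans ?_
    rw [abs_mul, abs_mul, abs_of_nonneg (sub_nonneg.2 hle), abs_of_pos hv]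
    have c1 := mul_le_mul_of_nonneg_left h1 (sub_nonneg.2 hle)
    have c2 := mul_le_mul_of_nonneg_left h2 hv.le
    linarith
  have huj : ∀ σ j, u σ (x (some j)) = if σ j then hi else lo := by
    intro σ j
    have e2 : min 1 (Metric.infDist (x (some j)) S / ρ) = 0 :=
      min_one_infDist_div_eq_zero (mem_range_self j)
    simp only [hu_def, e2]
    cases hσ : σ j
    · rw [min_one_infDist_div_eq_zero (S := S0 σ) (mem_insert_of_mem _ ⟨j, hσ, rfl⟩)]
      simp
    · rw [min_one_infDist_div_eq_one (S := S0 σ) (insert_nonempty _ _) hh]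
      · simp
      · rintro z (rfl | ⟨i, hi, rfl⟩)
        · rw [dist_comm]; exact hhρ.trans (hsep0 j)
        · refine hsep j i ?_
          rintro rfl
          rw [mem_ofPred_eq, hσ] at hi
          exact absurd hi (by simp)
  have hunone : ∀ σ, u σ (x none) = lo + v := by
    intro σ
    simp only [hu_def]
    rw [min_one_infDist_div_eq_zero (S := S0 σ) (mem_insert _ _),
      min_one_infDist_div_eq_one (S := S) (range_nonempty _) hρ]
    · simp
    · rintro z ⟨j, rfl⟩
      exact hsep0 j
  have hMhi : 2 * hi ≤ 2 / (M : ℝ) := by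
    have e : (2 : ℝ) / M = 2 * (1 / M) := by ring
    rw [e]; linarith
  obtain ⟨σ, hσ⟩ := exists_le_prob_ceExcessRisk (x := x) (k := k) (l := l) (t := 2 / M)
    (η := fun σ => twoClassPredictor hM hkl (u σ) (hum σ) (hu0 σ) (hu1 σ)) hW hlo.le hle hMhi
    (fun σ j => by rw [twoClassPredictor_apply_left, huj])
    (fun σ j => by rw [twoClassPredictor_apply_left, twoClassPredictor_apply_right])
    (fun σ σ' j m hmk hml => by
      rw [twoClassPredictor_apply_of_ne _ _ _ _ _ _ hmk hml,
        twoClassPredictor_apply_of_ne _ _ _ _ _ _ hmk hml])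
    (fun σ σ' => by simp only [twoClassPredictor, hunone]) hn A
  exact ⟨_, atomicMeasure_mem_holderSmallValueClass hM hkl (hum σ) (hu0 σ) (hu1 σ) hW hβ hlo hv hcβ
    (huhol σ) (fun j => hulo σ _) (hunone σ).ge hWlo hvβ hMβ, hσ⟩

/-! ### Geometry of the atoms and choice of parameters -/

/-- A coordinate cube fits inside the interior: the grid fills its positive orthant and the remote
atom is the opposite corner. The gap `ρ` does not shrink with `N`, so `v` can stay constant. -/
theorem exists_separated_grid {d : ℕ} (hd : 1 ≤ d) {𝒳 : Set (EuclideanSpace ℝ (Fin d))}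
    (h𝒳 : (interior 𝒳).Nonempty) : ∃ ρ : ℝ, 0 < ρ ∧ ∀ N : ℕ, 1 ≤ N →
      ∃ x : Option (Fin d → Fin N) → 𝒳,
        (∀ i j, i ≠ j → ρ / N ≤ dist (x (some i)) (x (some j))) ∧
        ∀ j, ρ ≤ dist (x none) (x (some j)) := by
  obtain ⟨a, ha⟩ := h𝒳
  have hopen : IsOpen ((WithLp.toLp 2 : (Fin d → ℝ) → EuclideanSpace ℝ (Fin d)) ⁻¹' interior 𝒳) :=
    isOpen_interior.preimage (PiLp.continuous_toLp 2 _)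
  obtain ⟨ε, hε, hball⟩ := Metric.isOpen_iff.1 hopen (WithLp.ofLp a) (by simpa using ha)
  have hmem : ∀ b : Fin d → ℝ, (∀ i, |b i| ≤ ε / 2) →
      (WithLp.toLp 2 (WithLp.ofLp a + b) : EuclideanSpace ℝ (Fin d)) ∈ 𝒳 := by
    intro b hb
    refine interior_subset (hball ?_)
    rw [Metric.mem_ball, dist_eq_norm, add_sub_cancel_left]
    exact ((pi_norm_le_iff_of_nonneg (by positivity)).2 hb).trans_lt (by linarith)
  have hdist : ∀ b c : Fin d → ℝ, ∀ i, |b i - c i| ≤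
      dist (WithLp.toLp 2 (WithLp.ofLp a + b) : EuclideanSpace ℝ (Fin d))
        (WithLp.toLp 2 (WithLp.ofLp a + c)) := by
    intro b c i
    rw [dist_eq_norm]
    have := PiLp.norm_apply_le ((WithLp.toLp 2 (WithLp.ofLp a + b) : EuclideanSpace ℝ (Fin d)) -
      WithLp.toLp 2 (WithLp.ofLp a + c)) i
    simpa using this
  refine ⟨ε / 2, by positivity, fun N hN => ?_⟩
  have hN0 : (0 : ℝ) < N := by exact_mod_cast hN
  have hh : 0 < ε / 2 / N := by positivity
  set off : Option (Fin d → Fin N) → Fin d → ℝ := fun o =>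
    o.elim (fun _ => -(ε / 2)) fun j i => ε / 2 / N * (j i : ℕ) with hoff
  have hoff_mem : ∀ o i, |off o i| ≤ ε / 2 := by
    rintro (_ | j) i
    · simp [hoff, abs_of_pos (half_pos hε)]
    · have h1 : ((j i : ℕ) : ℝ) ≤ N := by exact_mod_cast (j i).2.le
      change |ε / 2 / N * (j i : ℕ)| ≤ ε / 2
      rw [abs_of_nonneg (by positivity)]
      calc _ ≤ ε / 2 / N * N := mul_le_mul_of_nonneg_left h1 hh.le
        _ = _ := by field_simp
  refine ⟨fun o => ⟨_, hmem (off o) (hoff_mem o)⟩, fun i j hij => ?_, fun j => ?_⟩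
  · obtain ⟨t, ht⟩ := Function.ne_iff.1 hij
    refine le_trans ?_ (hdist (off (some i)) (off (some j)) t)
    change ε / 2 / N ≤ |ε / 2 / N * (i t : ℕ) - ε / 2 / N * (j t : ℕ)|
    rw [← mul_sub, abs_mul, abs_of_pos hh]
    have h1 : ((i t : ℕ) : ℤ) - (j t : ℕ) ≠ 0 := by
      rw [sub_ne_zero]
      exact_mod_cast fun h => ht (Fin.ext h)
    have h2 : (1 : ℝ) ≤ |((i t : ℕ) : ℝ) - (j t : ℕ)| := by exact_mod_cast Int.one_le_abs h1
    exact le_mul_of_one_le_right hh.le h2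
  · refine le_trans ?_ (hdist (off none) (off (some j)) ⟨0, hd⟩)
    change ε / 2 ≤ |-(ε / 2) - ε / 2 / N * (j ⟨0, hd⟩ : ℕ)|
    have h1 : 0 ≤ ε / 2 / N * ((j ⟨0, hd⟩ : ℕ) : ℝ) := by positivity
    rw [abs_of_nonpos (by linarith)]
    linarith

/-- Factor `δ` as a difference of squares; the squared sum of the roots lies between `lo + δ` and `4
* (lo + δ)`. -/
theorem sq_sqrt_add_sub_sqrt_bounds {lo δ : ℝ} (hlo : 0 < lo) (hδ : 0 < δ) :
    δ ^ 2 ≤ 4 * (lo + δ) * (√(lo + δ) - √lo) ^ 2 ∧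
      (lo + δ) * (√(lo + δ) - √lo) ^ 2 ≤ δ ^ 2 := by
  have h1 := Real.sq_sqrt hlo.le
  have h2 := Real.sq_sqrt (show 0 ≤ lo + δ by linarith)
  have h3 := Real.sqrt_nonneg lo
  have h4 : √lo ≤ √(lo + δ) := Real.sqrt_le_sqrt (by linarith)
  have hprod : δ ^ 2 = (√(lo + δ) + √lo) ^ 2 * (√(lo + δ) - √lo) ^ 2 := by
    rw [← mul_pow, ← sq_sub_sq, h1, h2]; ring
  have hs := sq_nonneg (√(lo + δ) - √lo)
  rw [hprod]
  constructor
  · refine mul_le_mul_of_nonneg_right ?_ hs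
    nlinarith
  · refine mul_le_mul_of_nonneg_right ?_ hs
    nlinarith

/-- The choice of the two probability levels `lo`, `lo + δ` and of the mass `W` put on them. -/
theorem exists_levels {v β : ℝ} (hv : 0 < v) (hv1 : v ≤ 1) (hβ : 0 ≤ β) :
    ∃ k₁ k₂ : ℝ, 0 < k₁ ∧ 0 < k₂ ∧ ∀ δ : ℝ, 0 < δ → δ ≤ v / 2 →
      ∃ lo W : ℝ, 0 < lo ∧ W ∈ Icc (0 : ℝ) 1 ∧ W ≤ lo ^ β ∧ lo + δ ≤ v ∧
        k₁ * δ ^ (1 + min β 1) ≤ W * (√(lo + δ) - √lo) ^ 2 ∧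
        W * (√(lo + δ) - √lo) ^ 2 ≤ k₂ * δ ^ (1 + min β 1) := by
  rcases le_total β 1 with hβ1 | hβ1
  -- With `lo = δ` the squared root gap is of order `δ`, and `W = δ ^ β`.
  · refine ⟨1 / 8, 1 / 2, by norm_num, by norm_num, fun δ hδ hδv => ⟨δ, δ ^ β, hδ,
      ⟨Real.rpow_nonneg hδ.le _, Real.rpow_le_one hδ.le (by linarith) hβ⟩, le_rfl,
      by linarith, ?_⟩⟩
    obtain ⟨h1, h2⟩ := sq_sqrt_add_sub_sqrt_bounds hδ hδ
    have hp : 0 < δ ^ β := Real.rpow_pos_of_pos hδ β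
    have h3 : δ / 8 ≤ (√(δ + δ) - √δ) ^ 2 := by
      by_contra! h
      nlinarith
    have h4 : (√(δ + δ) - √δ) ^ 2 ≤ δ / 2 := by
      by_contra! h
      nlinarith
    rw [min_eq_left hβ1, Real.rpow_add hδ, Real.rpow_one]
    constructor <;> nlinarith
  · have hb : 0 < v / 2 := by linarith
    have hp : 0 < (v / 2) ^ β := Real.rpow_pos_of_pos hb β
    have hp1 : (v / 2) ^ β ≤ 1 := Real.rpow_le_one hb.le (by linarith) hβ
    -- With `lo` of constant size the squared root gap is of order `δ ^ 2`, and `W` is constant.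
    refine ⟨(v / 2) ^ β / 4, 2 / v, by positivity, by positivity, fun δ hδ hδv =>
      ⟨v / 2, (v / 2) ^ β, hb, ⟨hp.le, hp1⟩, le_rfl, by linarith, ?_⟩⟩
    obtain ⟨h1, h2⟩ := sq_sqrt_add_sub_sqrt_bounds hb hδ
    have e : δ ^ (1 + min β 1) = δ ^ 2 := by
      rw [min_eq_right hβ1, ← Real.rpow_natCast]; norm_num
    have hs := sq_nonneg (√(v / 2 + δ) - √(v / 2))
    rw [e]
    constructor
    · have h3 : δ ^ 2 / 4 ≤ (√(v / 2 + δ) - √(v / 2)) ^ 2 := by nlinarith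
      calc _ = (v / 2) ^ β * (δ ^ 2 / 4) := by ring
        _ ≤ _ := mul_le_mul_of_nonneg_left h3 hp.le
    · calc _ ≤ (√(v / 2 + δ) - √(v / 2)) ^ 2 := mul_le_of_le_one_left hs hp1
        _ ≤ _ := by
          rw [div_mul_eq_mul_div, le_div_iff₀ hv]
          nlinarith

/-- A natural number of order `(K n)^(1/D)`. -/
theorem exists_nat_rpow_bounds {K D : ℝ} (hK : 1 ≤ K) (hD : 0 < D) {n : ℕ} (hn : 1 ≤ n) :
    ∃ N : ℕ, 1 ≤ N ∧ K * n ≤ (N : ℝ) ^ D ∧ (N : ℝ) ≤ 2 * K ^ (1 / D) * (n : ℝ) ^ (1 / D) := by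
  have hn1 : (1 : ℝ) ≤ n := by exact_mod_cast hn
  have hKn : 1 ≤ K * n := one_le_mul_of_one_le_of_one_le hK hn1
  have h1 : 1 ≤ (K * n) ^ (1 / D) := Real.one_le_rpow hKn (by positivity)
  have hle := Nat.le_ceil ((K * n) ^ (1 / D))
  refine ⟨⌈(K * n) ^ (1 / D)⌉₊, by exact_mod_cast h1.trans hle, ?_, ?_⟩
  · calc K * n = ((K * n) ^ (1 / D)) ^ D := by
          rw [← Real.rpow_mul (by linarith), one_div_mul_cancel hD.ne', Real.rpow_one]
      _ ≤ _ := Real.rpow_le_rpow (by linarith) hle hD.le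
  · have h2 := Nat.ceil_lt_add_one (show 0 ≤ (K * n) ^ (1 / D) by linarith)
    rw [mul_assoc, ← Real.mul_rpow (by linarith) (by linarith)]
    linarith

/-! ### Balancing the grid size against the sample size -/

theorem mainTheorem5 (d M : ℕ) (hd : 1 ≤ d) (hM : 2 ≤ M)
    (𝒳 : Set (EuclideanSpace ℝ (Fin d))) (h𝒳 : (interior 𝒳).Nonempty)
    (α β cα : ℝ) (hα : α ∈ Icc (0 : ℝ) 1) (hβ : 0 ≤ β) (hcα : 0 < cα) :
    ∃ cβ₀ : ℝ, 0 < cβ₀ ∧ ∃ c : ℝ, c ∈ Ioc (0 : ℝ) 1 ∧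
      ∀ cβ : ℝ, cβ₀ ≤ cβ → ∀ n : ℕ, 1 ≤ n →
        ∀ A : (Fin n → 𝒳 × Fin M) → Predictor 𝒳 M,
          ∃ P ∈ holderSmallValueClass 𝒳 M α β cα cβ,
            ENNReal.ofReal ((3 - 2 * Real.sqrt 2) / 8) ≤
              Measure.pi (fun _ : Fin n => P)
                {D | ENNReal.ofReal (c * (n : ℝ) ^ (-ceRateExponent d α β)) ≤
                  ceExcessRisk P (A D)} := by
  obtain ⟨ρ, hρ, hgrid⟩ := exists_separated_grid hd h𝒳
  have hM2 : (2 : ℝ) ≤ M := by exact_mod_cast hM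
  have hd1 : (1 : ℝ) ≤ d := by exact_mod_cast hd
  have hρα := Real.rpow_pos_of_pos hρ α
  -- The first bound is the Hölder budget across the gap `ρ`; the second leaves room for `hi + v ≤ 1
  -- / M`.
  set v : ℝ := min (cα / 2 * ρ ^ α) (1 / (2 * M)) with hv_def
  have hv : 0 < v := lt_min (by positivity) (by positivity)
  have hvρ : v ≤ cα / 2 * ρ ^ α := min_le_left _ _
  have hvM : v ≤ 1 / (2 * M) := min_le_right _ _
  have hv2M : v + v ≤ 1 / M := by
    have e : (1 : ℝ) / M = 1 / (2 * M) + 1 / (2 * M) := by field_simp; norm_num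
    linarith
  have hM1 : (1 : ℝ) / M ≤ 1 := by rw [div_le_one (by linarith)]; linarith
  have hv1 : v ≤ 1 := by linarith
  obtain ⟨k₁, k₂, hk₁, hk₂, hlev⟩ := exists_levels hv hv1 hβ
  set γ := 1 + min β 1 with hγ_def
  have hγ : 0 < γ := by have := le_min hβ zero_le_one; linarith
  set D : ℝ := γ * α + d with hD_def
  have hγα : 0 ≤ γ * α := mul_nonneg hγ.le hα.1
  have hD : 0 < D := by linarith
  -- The factor `4 * k₂` makes `K * n ≤ N ^ D` imply the indistinguishability condition.
  set K : ℝ := max 1 (4 * k₂) with hK_def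
  have hK : 1 ≤ K := le_max_left _ _
  set c₀ : ℝ := k₁ * (v / 2) ^ γ / 64 * (2 * K ^ (1 / D)) ^ (-(γ * α)) with hc₀_def
  have hKD : 0 < 2 * K ^ (1 / D) := by positivity
  have hc₀ : 0 < c₀ := by positivity
  have hvβ := Real.rpow_pos_of_pos hv β
  have hMβ := Real.rpow_pos_of_pos (show (0 : ℝ) < 1 / M by positivity) β
  refine ⟨1 + 1 / v ^ β + 1 / (1 / M : ℝ) ^ β, by positivity, min 1 c₀,
    ⟨lt_min one_pos hc₀, min_le_left _ _⟩, fun cβ hcβ n hn A => ?_⟩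
  have hn0 : (0 : ℝ) < n := by exact_mod_cast hn
  have i1 : 0 < 1 / v ^ β := by positivity
  have i2 : 0 < 1 / (1 / M : ℝ) ^ β := by positivity
  obtain ⟨N, hN, hNlow, hNup⟩ := exists_nat_rpow_bounds hK hD hn
  have hN1 : (1 : ℝ) ≤ N := by exact_mod_cast hN
  have hN0 : (0 : ℝ) < N := by linarith
  have hNα : (1 : ℝ) ≤ N ^ α := Real.one_le_rpow hN1 hα.1
  obtain ⟨x, hsep, hsep0⟩ := hgrid N hN
  set δ : ℝ := v / 2 / N ^ α with hδ_def
  have hδ : 0 < δ := by positivity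
  have hδv : δ ≤ v / 2 := div_le_self (by linarith) hNα
  obtain ⟨lo, W, hlo, hW, hWlo, hlov, hlow, hup⟩ := hlev δ hδ hδv
  have hδγ : δ ^ γ = (v / 2) ^ γ * (N : ℝ) ^ (-(γ * α)) := by
    rw [hδ_def, Real.div_rpow (by linarith) (by linarith), ← Real.rpow_mul hN0.le,
      Real.rpow_neg hN0.le, mul_comm α γ, div_eq_mul_inv]
  have : NeZero N := ⟨by omega⟩
  obtain ⟨P, hP, hPA⟩ := exists_mem_holderSmallValueClass_le_prob (cα := cα) (cβ := cβ)
    (hi := lo + δ) (h := ρ / N) hM hα hβ hW hlo (by linarith) hv (by linarith) (by linarith) hWlo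
    ((div_le_iff₀ hvβ).1 (by linarith)) ((div_le_iff₀ hMβ).1 (by linarith)) (by positivity) hρ
    (div_le_self hρ.le hN1) hsep hsep0 (by
      rw [Real.div_rpow hρ.le hN0.le, ← mul_div_assoc, add_sub_cancel_left]
      exact div_le_div_of_nonneg_right (by linarith) (by linarith)) hvρ (n := n) (by
      have hcard : (Fintype.card (Fin d → Fin N) : ℝ) = (N : ℝ) ^ (d : ℝ) := by simp
      have hND : (N : ℝ) ^ D * (N : ℝ) ^ (-(γ * α)) = (N : ℝ) ^ (d : ℝ) := by
        rw [← Real.rpow_add hN0]; congr 1; simp [hD_def]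
      have hvγ : (v / 2) ^ γ ≤ 1 := Real.rpow_le_one (by linarith) (by linarith) hγ.le
      have hNp : 0 < (N : ℝ) ^ (-(γ * α)) := Real.rpow_pos_of_pos hN0 _
      rw [hcard, ← hND]
      calc 4 * n * (W * (√(lo + δ) - √lo) ^ 2) ≤ 4 * n * (k₂ * δ ^ γ) :=
            mul_le_mul_of_nonneg_left hup (by positivity)
        _ ≤ 4 * n * (k₂ * (N : ℝ) ^ (-(γ * α))) := by
            rw [hδγ]
            gcongr
            exact mul_le_of_le_one_left hNp.le hvγ
        _ = 4 * k₂ * n * (N : ℝ) ^ (-(γ * α)) := by ring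
        _ ≤ (N : ℝ) ^ D * (N : ℝ) ^ (-(γ * α)) := by
            refine mul_le_mul_of_nonneg_right (le_trans ?_ hNlow) hNp.le
            exact mul_le_mul_of_nonneg_right (le_max_right _ _) hn0.le) A
  refine ⟨P, hP, le_trans (ENNReal.ofReal_le_ofReal ?_) (hPA.trans (measure_mono ?_))⟩
  -- This gives `(3 - 2 * √2) / 8 ≤ 1 / 16`, the probability supplied by Assouad's lemma.
  · have : (5 / 4 : ℝ) ≤ √2 := Real.le_sqrt_of_sq_le (by norm_num)
    linarith
  · intro S hS
    refine le_trans (ENNReal.ofReal_le_ofReal ?_) hS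
    have hrate : (n : ℝ) ^ (-ceRateExponent d α β) = ((n : ℝ) ^ (1 / D)) ^ (-(γ * α)) := by
      rw [← Real.rpow_mul hn0.le]
      congr 1
      rw [ceRateExponent, ← hγ_def, ← hD_def]
      ring
    have hNle : (2 * K ^ (1 / D)) ^ (-(γ * α)) * ((n : ℝ) ^ (1 / D)) ^ (-(γ * α)) ≤
        (N : ℝ) ^ (-(γ * α)) := by
      rw [← Real.mul_rpow hKD.le (by positivity)]
      exact Real.rpow_le_rpow_of_nonpos hN0 hNup (by linarith)
    have hnp : 0 < ((n : ℝ) ^ (1 / D)) ^ (-(γ * α)) := by positivity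
    calc min 1 c₀ * (n : ℝ) ^ (-ceRateExponent d α β) ≤
          c₀ * ((n : ℝ) ^ (1 / D)) ^ (-(γ * α)) := by
          rw [hrate]
          exact mul_le_mul_of_nonneg_right (min_le_right _ _) hnp.le
      _ = k₁ * (v / 2) ^ γ / 64 *
          ((2 * K ^ (1 / D)) ^ (-(γ * α)) * ((n : ℝ) ^ (1 / D)) ^ (-(γ * α))) := by
          rw [hc₀_def]; ring
      _ ≤ k₁ * (v / 2) ^ γ / 64 * (N : ℝ) ^ (-(γ * α)) :=
          mul_le_mul_of_nonneg_left hNle (by positivity)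
      _ = k₁ * δ ^ γ / 64 := by rw [hδγ]; ring
      _ ≤ _ := by linarith
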